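/- Let $p \ge 3$ be a prime number and let $k = \mathbb{F}_p(X_1, X_2, \dots)$ be the field of rational functions over $\mathbb{F}_p$ in the indeterminates $X_i$, $i \ge 1$. For $q \in k^*$ let $A_{(q)}$ be the Hopf algebra over $k$ generated as an algebra by two elements $g$ and $x$ subject to the relations $$ g^2 = 1, \qquad x^{2p} = q^{p-1} x^2, \qquad xg = -gx, $$ with the coalgebra structure for which $g$ is group-like and $x$ is $(1,g)$-primitive, that is, $\Delta(g) = g \otimes g$, $\varepsilon(g) = 1$, $\Delta(x) = x \otimes 1 + g \otimes x$, $\varepsilon(x) = 0$. Then every $A_{(X_i)}$, $i \ge 1$, has dimension $4p$ over $k$, and for $i \ne j$ the Hopf algebras $A_{(X_i)}$ and $A_{(X_j)}$ are not isomorphic. In particular, over the field $\mathbb{F}_3(X_1, X_2, \dots)$, which has characteristic $3$, there are infinitely many isomorphism classes of $12$-dimensional Hopf algebras. -/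

import Mathlib

open scoped TensorProduct

noncomputable section

namespace SweedlerCrossed

/-- The two generators `g` and `x`. -/
inductive Gen : Type
  | g : Gen
  | x : Gen

/-- The relations `g² = 1`, `x^{2p} = q^{p-1} x²`, `x g = - g x` in the free algebra `k⟨g, x⟩`. -/
inductive Rel (k : Type*) [Field k] (p : ℕ) (q : k) :
    FreeAlgebra k Gen → FreeAlgebra k Gen → Prop
  | g_sq : Rel k p q (FreeAlgebra.ι k Gen.g ^ 2) 1
  | x_pow : Rel k p q (FreeAlgebra.ι k Gen.x ^ (2 * p))
      (q ^ (p - 1) • FreeAlgebra.ι k Gen.x ^ 2)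
  | x_g : Rel k p q (FreeAlgebra.ι k Gen.x * FreeAlgebra.ι k Gen.g)
      (-(FreeAlgebra.ι k Gen.g * FreeAlgebra.ι k Gen.x))

/-- The algebra `A_(q)` over `k`, generated by `g` and `x` subject to the relations
`g² = 1`, `x^{2p} = q^{p-1} x²`, `x g = - g x`. The Hopf algebra structure is given below. -/
def A (k : Type*) [Field k] (p : ℕ) (q : k) : Type _ := RingQuot (Rel k p q)

namespace A

variable (k : Type*) [Field k] (p : ℕ) (q : k)

instance instRing : Ring (A k p q) := inferInstanceAs (Ring (RingQuot (Rel k p q)))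

instance instAlgebra : Algebra k (A k p q) := inferInstanceAs (Algebra k (RingQuot (Rel k p q)))

/-- The quotient map from the free algebra. -/
def mk : FreeAlgebra k Gen →ₐ[k] A k p q := RingQuot.mkAlgHom k (Rel k p q)

/-- The generator `g` of `A_(q)`. -/
def g : A k p q := mk k p q (FreeAlgebra.ι k Gen.g)

/-- The generator `x` of `A_(q)`. -/
def x : A k p q := mk k p q (FreeAlgebra.ι k Gen.x)

lemma g_sq : g k p q ^ 2 = 1 := by
  have h := RingQuot.mkAlgHom_rel k (Rel.g_sq (k := k) (p := p) (q := q))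
  rw [map_pow, map_one] at h
  exact h

lemma g_mul_g : g k p q * g k p q = 1 := by rw [← pow_two, g_sq]

lemma x_pow : x k p q ^ (2 * p) = q ^ (p - 1) • x k p q ^ 2 := by
  have h := RingQuot.mkAlgHom_rel k (Rel.x_pow (k := k) (p := p) (q := q))
  rw [map_pow, map_smul, map_pow] at h
  exact h

lemma x_mul_g : x k p q * g k p q = -(g k p q * x k p q) := by
  have h := RingQuot.mkAlgHom_rel k (Rel.x_g (k := k) (p := p) (q := q))
  rw [map_mul, map_neg, map_mul] at h
  exact h

variable {k p q}

section lift

variable {B : Type*} [Ring B] [Algebra k B]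

/-- The universal property of `A_(q)`. -/
def lift (a b : B) (h₁ : a ^ 2 = 1) (h₂ : b ^ (2 * p) = q ^ (p - 1) • b ^ 2)
    (h₃ : b * a = -(a * b)) : A k p q →ₐ[k] B :=
  RingQuot.liftAlgHom k (s := Rel k p q)
    ⟨FreeAlgebra.lift k (fun t => Gen.casesOn t a b), by
      intro u v huv
      cases huv <;> simp [h₁, h₂, h₃]⟩

variable (a b : B) (h₁ : a ^ 2 = 1) (h₂ : b ^ (2 * p) = q ^ (p - 1) • b ^ 2)
  (h₃ : b * a = -(a * b))

@[simp] lemma lift_g : lift (q := q) a b h₁ h₂ h₃ (g k p q) = a := by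
  simp [lift, g, mk]
  erw [RingQuot.liftAlgHom_mkAlgHom_apply]
  simp

@[simp] lemma lift_x : lift (q := q) a b h₁ h₂ h₃ (x k p q) = b := by
  simp [lift, x, mk]
  erw [RingQuot.liftAlgHom_mkAlgHom_apply]
  simp

lemma algHom_ext' {S : Type*} [Semiring S] [Algebra k S] {u v : A k p q →ₐ[k] S}
    (hg : u (g k p q) = v (g k p q)) (hx : u (x k p q) = v (x k p q)) : u = v := by
  refine RingQuot.ringQuot_ext' k (s := Rel k p q) u v ?_
  refine FreeAlgebra.hom_ext (funext fun t => ?_)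
  cases t
  · exact hg
  · exact hx

@[elab_as_elim]
lemma induction {P : A k p q → Prop} (hs : ∀ c : k, P (algebraMap k _ c))
    (hg : P (g k p q)) (hx : P (x k p q)) (hmul : ∀ a b, P a → P b → P (a * b))
    (hadd : ∀ a b, P a → P b → P (a + b)) (a : A k p q) : P a := by
  obtain ⟨a, rfl⟩ := RingQuot.mkAlgHom_surjective k (Rel k p q) a
  change P (mk k p q a)
  induction a using FreeAlgebra.induction with
  | grade0 r => rw [AlgHom.commutes]; exact hs r
  | grade1 t => cases t <;> assumption
  | mul a b ha hb => rw [map_mul]; exact hmul _ _ ha hb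
  | add a b ha hb => rw [map_add]; exact hadd _ _ ha hb

end lift

section Hopf

variable (k p q)

lemma comul_x_sq :
    (x k p q ⊗ₜ[k] (1 : A k p q) + g k p q ⊗ₜ[k] x k p q) ^ 2 =
      (x k p q ^ 2) ⊗ₜ[k] 1 + 1 ⊗ₜ[k] (x k p q ^ 2) := by
  simp only [pow_two, add_mul, mul_add, Algebra.TensorProduct.tmul_mul_tmul, mul_one, one_mul,
    x_mul_g, g_mul_g, TensorProduct.neg_tmul]
  abel

variable [Fact p.Prime]

/-- The counit: `ε(g) = 1`, `ε(x) = 0`. -/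
def counitHom : A k p q →ₐ[k] k :=
  lift 1 0 (by simp) (by simp [(Fact.out : p.Prime).ne_zero]) (by simp)

@[simp] lemma counitHom_g : counitHom k p q (g k p q) = 1 := by simp [counitHom]

@[simp] lemma counitHom_x : counitHom k p q (x k p q) = 0 := by simp [counitHom]

instance : Nontrivial (A k p q) := (counitHom k p q).toRingHom.domain_nontrivial

instance : Nontrivial (A k p q ⊗[k] A k p q) :=
  (Algebra.TensorProduct.lift (counitHom k p q) (counitHom k p q)
    fun _ _ => Commute.all _ _).toRingHom.domain_nontrivial

variable [CharP k p]

/-- The comultiplication: `g` is group-like and `x` is `(1, g)`-primitive, that is,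
`Δ(g) = g ⊗ g` and `Δ(x) = x ⊗ 1 + g ⊗ x`. -/
def comulHom : A k p q →ₐ[k] A k p q ⊗[k] A k p q :=
  lift (g k p q ⊗ₜ g k p q) (x k p q ⊗ₜ 1 + g k p q ⊗ₜ x k p q)
    (by rw [Algebra.TensorProduct.tmul_pow, g_sq, Algebra.TensorProduct.one_def])
    (by
      have : CharP (A k p q ⊗[k] A k p q) p :=
        charP_of_injective_algebraMap (algebraMap k _).injective p
      rw [pow_mul, comul_x_sq, add_pow_char_of_commute]
      · simp only [Algebra.TensorProduct.tmul_pow, one_pow, ← pow_mul, x_pow, smul_add,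
          TensorProduct.smul_tmul', TensorProduct.tmul_smul]
      · simp [Commute, SemiconjBy])
    (by
      simp only [add_mul, mul_add, Algebra.TensorProduct.tmul_mul_tmul, mul_one, one_mul,
        x_mul_g, TensorProduct.neg_tmul, TensorProduct.tmul_neg, neg_add])

@[simp] lemma comulHom_g : comulHom k p q (g k p q) = g k p q ⊗ₜ g k p q := by simp [comulHom]

@[simp] lemma comulHom_x :
    comulHom k p q (x k p q) = x k p q ⊗ₜ 1 + g k p q ⊗ₜ x k p q := by simp [comulHom]

instance instBialgebra : Bialgebra k (A k p q) :=
  .ofAlgHom (comulHom k p q) (counitHom k p q)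
    (algHom_ext' (by simp)
      (by simp [TensorProduct.add_tmul, TensorProduct.tmul_add, Algebra.TensorProduct.one_def,
        add_assoc]))
    (algHom_ext' (by simp) (by simp))
    (algHom_ext' (by simp) (by simp))

/-- The comultiplication of `A_(q)` makes `g` group-like. -/
@[simp] lemma comul_g : Coalgebra.comul (R := k) (g k p q) = g k p q ⊗ₜ g k p q :=
  comulHom_g k p q

/-- The comultiplication of `A_(q)` makes `x` a `(1, g)`-primitive element. -/
@[simp] lemma comul_x :
    Coalgebra.comul (R := k) (x k p q) = x k p q ⊗ₜ 1 + g k p q ⊗ₜ x k p q :=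
  comulHom_x k p q

@[simp] lemma counit_g : Coalgebra.counit (R := k) (g k p q) = 1 := counitHom_g k p q

@[simp] lemma counit_x : Coalgebra.counit (R := k) (x k p q) = 0 := counitHom_x k p q

open MulOpposite in
/-- The antipode as an algebra map to the opposite algebra: `S(g) = g`, `S(x) = - g x`. -/
def antipodeHom : A k p q →ₐ[k] (A k p q)ᵐᵒᵖ :=
  lift (op (g k p q)) (op (-(g k p q * x k p q)))
    (by rw [← op_pow, g_sq, op_one])
    (by
      have : CharP (A k p q) p :=
        charP_of_injective_algebraMap (algebraMap k _).injective p
      have h : (-(g k p q * x k p q)) ^ 2 = -(x k p q ^ 2) := by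
        rw [neg_sq, pow_two, mul_assoc, ← mul_assoc (x k p q), x_mul_g, neg_mul, mul_neg,
          ← mul_assoc, ← mul_assoc, g_mul_g, one_mul, pow_two]
      rw [← op_pow, ← op_pow, ← op_smul, pow_mul, h, neg_pow, neg_one_pow_char, ← pow_mul, x_pow]
      simp)
    (by
      rw [← op_mul, ← op_mul, ← op_neg]
      simp [mul_assoc, x_mul_g])

/-- The antipode of `A_(q)`. -/
def antipodeMap : A k p q →ₗ[k] A k p q :=
  (MulOpposite.opLinearEquiv k).symm.toLinearMap ∘ₗ (antipodeHom k p q).toLinearMap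

lemma antipodeMap_apply (a : A k p q) :
    antipodeMap k p q a = MulOpposite.unop (antipodeHom k p q a) := rfl

@[simp] lemma antipodeMap_g : antipodeMap k p q (g k p q) = g k p q := by
  simp [antipodeMap_apply, antipodeHom]

@[simp] lemma antipodeMap_x : antipodeMap k p q (x k p q) = -(g k p q * x k p q) := by
  simp [antipodeMap_apply, antipodeHom]

lemma antipodeMap_mul (a b : A k p q) :
    antipodeMap k p q (a * b) = antipodeMap k p q b * antipodeMap k p q a := by
  simp [antipodeMap_apply]

lemma antipodeMap_one : antipodeMap k p q 1 = 1 := by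
  simp [antipodeMap_apply]

open Coalgebra LinearMap

lemma antipode_left (a : A k p q) :
    mul' k (A k p q) ((antipodeMap k p q).rTensor _ (comul a)) = algebraMap k _ (counit a) := by
  induction a using induction with
  | hs c => simp [Algebra.algebraMap_eq_smul_one, Algebra.TensorProduct.one_def,
      antipodeMap_one]
  | hg => simp [g_mul_g]
  | hx => simp
  | hadd a b ha hb => simp [ha, hb]
  | hmul a b ha hb =>
    have key : ∀ u v : A k p q ⊗[k] A k p q,
        mul' k (A k p q) ((antipodeMap k p q).rTensor _ u) = algebraMap k _ (counit a) →
        mul' k (A k p q) ((antipodeMap k p q).rTensor _ (u * v)) =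
          counit (R := k) a • mul' k (A k p q) ((antipodeMap k p q).rTensor _ v) := by
      intro u v hu
      induction v using TensorProduct.induction_on with
      | zero => simp
      | add v w hv hw => simp [mul_add, hv, hw]
      | tmul c d =>
        have aux : mul' k (A k p q) ((antipodeMap k p q).rTensor _ (u * c ⊗ₜ d)) =
            antipodeMap k p q c * mul' k (A k p q) ((antipodeMap k p q).rTensor _ u) * d := by
          clear hu
          induction u using TensorProduct.induction_on with
          | zero => simp
          | add u w hu hw => simp [add_mul, mul_add, hu, hw]
          | tmul e f => simp [antipodeMap_mul, mul_assoc]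
        rw [aux, hu, ← Algebra.commutes, mul_assoc, ← Algebra.smul_def]
        simp
    rw [Bialgebra.comul_mul, key _ _ ha, hb, Bialgebra.counit_mul, map_mul, Algebra.smul_def]

lemma antipode_right (a : A k p q) :
    mul' k (A k p q) ((antipodeMap k p q).lTensor _ (comul a)) = algebraMap k _ (counit a) := by
  induction a using induction with
  | hs c => simp [Algebra.algebraMap_eq_smul_one, Algebra.TensorProduct.one_def,
      antipodeMap_one]
  | hg => simp [g_mul_g]
  | hx => simp [antipodeMap_one, ← mul_assoc, g_mul_g]
  | hadd a b ha hb => simp [ha, hb]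
  | hmul a b ha hb =>
    have key : ∀ u v : A k p q ⊗[k] A k p q,
        mul' k (A k p q) ((antipodeMap k p q).lTensor _ v) = algebraMap k _ (counit b) →
        mul' k (A k p q) ((antipodeMap k p q).lTensor _ (u * v)) =
          counit (R := k) b • mul' k (A k p q) ((antipodeMap k p q).lTensor _ u) := by
      intro u v hv
      induction u using TensorProduct.induction_on with
      | zero => simp
      | add v w hv hw => simp [add_mul, hv, hw]
      | tmul c d =>
        have aux : mul' k (A k p q) ((antipodeMap k p q).lTensor _ (c ⊗ₜ d * v)) =
            c * mul' k (A k p q) ((antipodeMap k p q).lTensor _ v) * antipodeMap k p q d := by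
          clear hv
          induction v using TensorProduct.induction_on with
          | zero => simp
          | add u w hu hw => simp [add_mul, mul_add, hu, hw]
          | tmul e f => simp [antipodeMap_mul, mul_assoc]
        rw [aux, hv, ← Algebra.commutes, mul_assoc, ← Algebra.smul_def]
        simp
    rw [Bialgebra.comul_mul, key _ _ hb, ha, Bialgebra.counit_mul, map_mul, Algebra.smul_def,
      Algebra.commutes]

instance instHopfAlgebra : HopfAlgebra k (A k p q) where
  antipode := antipodeMap k p q
  mul_antipode_rTensor_comul := LinearMap.ext (antipode_left k p q)
  mul_antipode_lTensor_comul := LinearMap.ext (antipode_right k p q)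

end Hopf

end A

/-- The field `𝔽_p(X₁, X₂, …)` of rational functions in the indeterminates `X_i`, `i ≥ 1`. -/
abbrev RatFunField (p : ℕ) [Fact p.Prime] : Type := FractionRing (MvPolynomial ℕ+ (ZMod p))

/-- The indeterminate `X_i` in `𝔽_p(X₁, X₂, …)`. -/
def X (p : ℕ) [Fact p.Prime] (i : ℕ+) : RatFunField p :=
  algebraMap (MvPolynomial ℕ+ (ZMod p)) (RatFunField p) (MvPolynomial.X i)

/-- The set of isomorphism classes of Hopf algebras of dimension `n` over the field `k`. -/
def hopfIsoClasses (k : Type) [Field k] (n : ℕ) :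
    Set (Quotient (CategoryTheory.isIsomorphicSetoid (HopfAlgCat.{0} k))) :=
  {c | ∃ H : HopfAlgCat.{0} k, Module.finrank k H = n ∧ Quotient.mk _ H = c}

end SweedlerCrossed

end

/-! Write `y = x²`, a central element. Sending `g` to `i` and `x` to `j` maps `A_(q)` to the
quaternion algebra with `i² = 1`, `j² = Y` over `k[Y]/(Y^p - q^{p-1} Y)`, where the images of the
`4p` monomials `mono` form a `k`-basis. So the monomials are independent; they span because their
span is stable under `g` and `x`.

In this basis the coproduct is explicit, since `y` is primitive. Comparing coordinates shows that
`1` and `g` are the only group-likes (`eq_one_or_eq_g_of_groupLike`) and that a `(1, g)`-primitive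
element anticommuting with `g` is a multiple of `x` (`eq_smul_x_of_skewPrimitive`). An isomorphism
`A_(q) → A_(q')` therefore fixes `g` and sends `x` to `α x`, and the relation for `x^{2p}` forces
`(α² q')^{p-1} = q^{p-1}`. For `q = X_i`, `q' = X_j` this fails by parity of the order at `X_i`
(`X_pow_ne`). -/

noncomputable section

namespace SweedlerCrossed

namespace A

/-- The polynomial `Y^p - q^{p-1} Y`. -/
def artinPoly (k : Type*) [Field k] (p : ℕ) (q : k) : Polynomial k :=
  Polynomial.X ^ p - Polynomial.C (q ^ (p - 1)) * Polynomial.X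

/-! ### A monomial basis and the dimension -/

section basis

variable {k : Type*} [Field k] {p : ℕ} {q : k}

lemma natDegree_linear_lt (hp : 1 < p) :
    (Polynomial.C (q ^ (p - 1)) * Polynomial.X).natDegree < p :=
  ((Polynomial.natDegree_C_mul_le _ _).trans Polynomial.natDegree_X_le).trans_lt hp

lemma artinPoly_monic (hp : 1 < p) : (artinPoly k p q).Monic :=
  Polynomial.monic_X_pow_sub (Polynomial.degree_le_natDegree.trans_lt
    (by exact_mod_cast natDegree_linear_lt (q := q) hp))

lemma natDegree_artinPoly (hp : 1 < p) : (artinPoly k p q).natDegree = p := by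
  rw [artinPoly, Polynomial.natDegree_sub_eq_left_of_natDegree_lt] <;>
    rw [Polynomial.natDegree_X_pow]
  exact natDegree_linear_lt hp

variable (k p q) in
/-- The commutative algebra `k[Y]/(Y^p - q^{p-1} Y)`. -/
abbrev Base : Type _ := AdjoinRoot (artinPoly k p q)

variable (k p q) in
/-- The class of `Y` in `k[Y]/(Y^p - q^{p-1} Y)`. -/
abbrev baseRoot : Base k p q := AdjoinRoot.root (artinPoly k p q)

lemma baseRoot_pow : baseRoot k p q ^ p = q ^ (p - 1) • baseRoot k p q := by
  have h : AdjoinRoot.mk (artinPoly k p q)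
      (Polynomial.X ^ p - Polynomial.C (q ^ (p - 1)) * Polynomial.X) = 0 := AdjoinRoot.mk_self
  rw [map_sub, sub_eq_zero, map_pow, map_mul, AdjoinRoot.mk_X, AdjoinRoot.mk_C] at h
  rw [Algebra.smul_def]
  exact h

variable (k p q) in
/-- The map from `A_(q)` to the quaternion algebra over `k[Y]/(Y^p - q^{p-1} Y)` with
`i² = 1`, `j² = Y`, sending `g` to `i` and `x` to `j`. -/
def toQuaternion : A k p q →ₐ[k] QuaternionAlgebra (Base k p q) 1 0 (baseRoot k p q) :=
  lift ⟨0, 1, 0, 0⟩ ⟨0, 0, 1, 0⟩ (by ext <;> simp [pow_two])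
    (by
      have h : (⟨0, 0, 1, 0⟩ : QuaternionAlgebra (Base k p q) 1 0 (baseRoot k p q)) ^ 2 =
          algebraMap _ _ (baseRoot k p q) := by
        ext <;> simp [pow_two, QuaternionAlgebra.algebraMap_eq]
      rw [pow_mul, h, ← map_pow, baseRoot_pow, Algebra.smul_def, map_mul, Algebra.smul_def]
      rfl)
    (by ext <;> simp)

variable (k p q) in
/-- The monomials `y^a`, `g y^a`, `x y^a`, `g x y^a`, where `y = x²`. -/
def mono (l : Fin 4) (a : ℕ) : A k p q :=
  ![1, g k p q, x k p q, g k p q * x k p q] l * (x k p q ^ 2) ^ a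

lemma toQuaternion_mono (l : Fin 4) (a : ℕ) :
    toQuaternion k p q (mono k p q l a) =
      (baseRoot k p q) ^ a • QuaternionAlgebra.basisOneIJK 1 0 (baseRoot k p q) l := by
  have h : (⟨0, 0, 1, 0⟩ : QuaternionAlgebra (Base k p q) 1 0 (baseRoot k p q)) ^ 2 =
      algebraMap _ _ (baseRoot k p q) := by
    ext <;> simp [pow_two, QuaternionAlgebra.algebraMap_eq]
  have h2 : toQuaternion k p q ((x k p q ^ 2) ^ a) =
      algebraMap _ _ (baseRoot k p q ^ a) := by
    rw [map_pow, map_pow, toQuaternion, lift_x, h, map_pow]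
  rw [mono, map_mul, h2, ← Algebra.commutes, ← Algebra.smul_def]
  congr 1
  apply (QuaternionAlgebra.basisOneIJK 1 0 (baseRoot k p q)).repr.injective
  rw [Module.Basis.repr_self]
  ext m
  rw [QuaternionAlgebra.coe_basisOneIJK_repr]
  fin_cases l <;> fin_cases m <;> simp [toQuaternion]

/-- The images in the quaternion algebra are the products of the power basis of `Base` with `1, i,
j, ij`, a basis over `k` by the tower construction. -/
lemma linearIndependent_mono (hp : 1 < p) :
    LinearIndependent k (fun i : Fin p × Fin 4 => mono k p q i.2 i.1) := by
  let b := ((AdjoinRoot.powerBasis' (artinPoly_monic (k := k) (q := q) hp)).basis.reindex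
    (finCongr (natDegree_artinPoly hp))).smulTower
      (QuaternionAlgebra.basisOneIJK 1 0 (baseRoot k p q))
  apply LinearIndependent.of_comp (toQuaternion k p q).toLinearMap
  convert b.linearIndependent using 1
  swap
  · rfl
  ext1 i
  simp only [b, Function.comp_apply, AlgHom.toLinearMap_apply, toQuaternion_mono,
    Module.Basis.smulTower_apply, Module.Basis.reindex_apply, PowerBasis.coe_basis]
  rfl

lemma x_sq_comm_g : x k p q ^ 2 * g k p q = g k p q * x k p q ^ 2 := by
  rw [pow_two, mul_assoc, x_mul_g, mul_neg, ← mul_assoc, x_mul_g, neg_mul, neg_neg, mul_assoc]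

lemma g_mul_mono (l : Fin 4) (a : ℕ) :
    g k p q * mono k p q l a = mono k p q (![1, 0, 3, 2] l) a := by
  fin_cases l <;> simp [mono, ← mul_assoc, g_mul_g]

lemma span_mono (hp : 1 < p) :
    ⊤ ≤ Submodule.span k (Set.range fun i : Fin p × Fin 4 => mono k p q i.2 i.1) := by
  set S := Submodule.span k (Set.range fun i : Fin p × Fin 4 => mono k p q i.2 i.1) with hS
  have hlt (l : Fin 4) {a : ℕ} (ha : a < p) : mono k p q l a ∈ S :=
    Submodule.subset_span ⟨(⟨a, ha⟩, l), rfl⟩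
  -- Multiplying `x y^a` by `x` raises the exponent by one, so `y^p` can occur; it is reduced by
  -- `y^p = q^{p-1} y`.
  have hle (l : Fin 4) {a : ℕ} (ha : a ≤ p) : mono k p q l a ∈ S := by
    rcases ha.lt_or_eq with h | rfl
    · exact hlt l h
    · have : mono k a q l a = q ^ (a - 1) • mono k a q l 1 := by
        rw [mono, mono, ← pow_mul, x_pow, mul_smul_comm, pow_one]
      rw [this]
      exact S.smul_mem _ (hlt l hp)
  have key (c : A k p q) (hc : ∀ i : Fin p × Fin 4, c * mono k p q i.2 i.1 ∈ S) :
      ∀ s ∈ S, c * s ∈ S := by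
    intro s hs
    induction hs using Submodule.span_induction with
    | mem s hs => obtain ⟨i, rfl⟩ := hs; exact hc i
    | zero => simp
    | add u v _ _ hu hv => rw [mul_add]; exact S.add_mem hu hv
    | smul r u _ hu => rw [mul_smul_comm]; exact S.smul_mem _ hu
  -- `S` is a left ideal; as it contains `1`, it is everything.
  have hmul : ∀ c : A k p q, ∀ s ∈ S, c * s ∈ S := by
    intro c
    induction c using induction with
    | hs r => intro s hs; rw [← Algebra.smul_def]; exact S.smul_mem _ hs
    | hmul u v hu hv => intro s hs; rw [mul_assoc]; exact hu _ (hv _ hs)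
    | hadd u v hu hv => intro s hs; rw [add_mul]; exact S.add_mem (hu _ hs) (hv _ hs)
    | hg =>
      apply key
      rintro ⟨a, l⟩
      simp only [g_mul_mono]
      exact hlt _ a.2
    | hx =>
      apply key
      rintro ⟨a, l⟩
      have hs (a : ℕ) : x k p q * (x k p q * (x k p q ^ 2) ^ a) = (x k p q ^ 2) ^ (a + 1) := by
        rw [← mul_assoc, ← pow_two, ← pow_succ']
      have hg (u : A k p q) : x k p q * (g k p q * u) = -(g k p q * (x k p q * u)) := by
        rw [← mul_assoc, x_mul_g, neg_mul, mul_assoc]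
      fin_cases l
      · convert hlt 2 a.2 using 1
        simp [mono]
      · convert S.neg_mem (hlt 3 a.2) using 1
        simp [mono, hg, mul_assoc]
      · convert hle 0 a.2 using 1
        simp [mono, hs]
      · convert S.neg_mem (hle 1 a.2) using 1
        simp [mono, hg, hs, mul_assoc]
  intro c _
  have h1 : (1 : A k p q) ∈ S := by
    have := hlt 0 (zero_lt_one.trans hp)
    simpa [mono] using this
  simpa using hmul c 1 h1

variable (k q) in
/-- The basis of `A_(q)` formed by `y^a`, `g y^a`, `x y^a`, `g x y^a` for `a < p`,
where `y = x²`. -/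
def basis (hp : 1 < p) : Module.Basis (Fin p × Fin 4) k (A k p q) :=
  .mk (linearIndependent_mono hp) (span_mono hp)

lemma basis_apply (hp : 1 < p) (i : Fin p × Fin 4) : basis k q hp i = mono k p q i.2 i.1 := by
  simp [basis]

lemma finrank_eq (hp : 1 < p) : Module.finrank k (A k p q) = 4 * p := by
  rw [Module.finrank_eq_card_basis (basis k q hp)]
  simp [mul_comm]

end basis

/-! ### The coproduct in coordinates and the group-like elements -/

section coalgebra

variable {k : Type*} [Field k] {p : ℕ} {q : k}

lemma basis_coord_mono (hp : 1 < p) (i : Fin p × Fin 4) (l : Fin 4) {a : ℕ} (ha : a < p) :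
    (basis k q hp).coord i (mono k p q l a) = if a = i.1 ∧ l = i.2 then 1 else 0 := by
  have h := basis_apply (k := k) (q := q) hp (⟨a, ha⟩, l)
  rw [← h, Module.Basis.coord_apply, Module.Basis.repr_self, Finsupp.single_apply]
  congr 1
  simp [Prod.ext_iff, Fin.ext_iff]

lemma mono_zero_zero : mono k p q 0 0 = 1 := by simp [mono]

lemma mono_one_zero : mono k p q 1 0 = g k p q := by simp [mono]

lemma mono_two_zero : mono k p q 2 0 = x k p q := by simp [mono]

lemma sum_coord_mono (hp : 1 < p) (z : A k p q) :
    ∑ i : Fin p × Fin 4, (basis k q hp).coord i z • mono k p q i.2 i.1 = z := by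
  conv_rhs => rw [← (basis k q hp).sum_repr z]
  simp [basis_apply]

lemma mono_mul_g (l : Fin 4) (a : ℕ) :
    mono k p q l a * g k p q = (![1, 1, -1, -1] l : k) • mono k p q (![1, 0, 3, 2] l) a := by
  have h : (x k p q ^ 2) ^ a * g k p q = g k p q * (x k p q ^ 2) ^ a :=
    (show Commute (x k p q ^ 2) (g k p q) from x_sq_comm_g).pow_left a
  rw [mono, mul_assoc, h, ← mul_assoc]
  fin_cases l <;> simp [mono, g_mul_g, x_mul_g, mul_assoc]
  rw [← mul_assoc (g k p q), g_mul_g, one_mul]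

lemma coord_g_mul (hp : 1 < p) (a : Fin p) (l : Fin 4) (z : A k p q) :
    (basis k q hp).coord (a, ![1, 0, 3, 2] l) (g k p q * z) = (basis k q hp).coord (a, l) z := by
  suffices h : (basis k q hp).coord (a, ![1, 0, 3, 2] l) ∘ₗ LinearMap.mulLeft k (g k p q) =
      (basis k q hp).coord (a, l) from LinearMap.congr_fun h z
  refine (basis k q hp).ext fun i => ?_
  rw [LinearMap.comp_apply, LinearMap.mulLeft_apply, basis_apply, g_mul_mono,
    basis_coord_mono hp _ _ i.1.2, basis_coord_mono hp _ _ i.1.2]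
  congr 2
  exact propext ((show ∀ l l' : Fin 4, (![1, 0, 3, 2] l' : Fin 4) = ![1, 0, 3, 2] l ↔ l' = l by
    decide) l i.2)

/-- The signs arise because the types containing `x` anticommute with `g`, while the other two
commute with it. -/
lemma coord_mul_g (hp : 1 < p) (a : Fin p) (l : Fin 4) (z : A k p q) :
    (basis k q hp).coord (a, ![1, 0, 3, 2] l) (z * g k p q) =
      ![1, 1, -1, -1] l * (basis k q hp).coord (a, l) z := by
  suffices h : (basis k q hp).coord (a, ![1, 0, 3, 2] l) ∘ₗ LinearMap.mulRight k (g k p q) =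
      (![1, 1, -1, -1] l : k) • (basis k q hp).coord (a, l) from LinearMap.congr_fun h z
  refine (basis k q hp).ext fun i => ?_
  have h := (show ∀ l l' : Fin 4, (![1, 0, 3, 2] l' : Fin 4) = ![1, 0, 3, 2] l ↔ l' = l by
    decide) l i.2
  rw [LinearMap.comp_apply, LinearMap.mulRight_apply, basis_apply, mono_mul_g, map_smul,
    LinearMap.smul_apply, basis_coord_mono hp _ _ i.1.2, basis_coord_mono hp _ _ i.1.2]
  by_cases hl : i.2 = l <;> simp [h, hl]

variable (k p q) in
/-- The tensor product of two linear functionals. -/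
def pairing (φ ψ : A k p q →ₗ[k] k) : A k p q ⊗[k] A k p q →ₗ[k] k :=
  LinearMap.mul' k k ∘ₗ TensorProduct.map φ ψ

@[simp] lemma pairing_tmul (φ ψ : A k p q →ₗ[k] k) (a b : A k p q) :
    pairing k p q φ ψ (a ⊗ₜ b) = φ a * ψ b := by
  simp [pairing]

/-- The types of the monomials that occur in the comultiplication of a monomial. -/
def comulTypes : Fin 4 → Finset (Fin 4 × Fin 4) :=
  ![{(0, 0)}, {(1, 1)}, {(2, 0), (1, 2)}, {(3, 1), (0, 3)}]

variable [Fact p.Prime] [CharP k p]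

/-- Since `y` is primitive, `Δ(y^a)` is a binomial expansion; the prefactor `1, g, x, gx`
contributes the pairs in `comulTypes`. -/
lemma comul_mono (l : Fin 4) (a : ℕ) :
    Coalgebra.comul (R := k) (mono k p q l a) =
      ∑ t ∈ comulTypes l, ∑ s ∈ Finset.HasAntidiagonal.antidiagonal a,
        a.choose s.1 • (mono k p q t.1 s.1 ⊗ₜ[k] mono k p q t.2 s.2) := by
  have hy : Coalgebra.comul (R := k) ((x k p q ^ 2) ^ a) = ∑ s ∈ Finset.HasAntidiagonal.antidiagonal a,
      a.choose s.1 • (((x k p q ^ 2) ^ s.1) ⊗ₜ[k] ((x k p q ^ 2) ^ s.2)) := by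
    rw [Bialgebra.comul_pow, Bialgebra.comul_pow, comul_x, comul_x_sq, Commute.add_pow']
    · simp
    · simp [Commute, SemiconjBy]
  have hpre : Coalgebra.comul (R := k) (![1, g k p q, x k p q, g k p q * x k p q] l) =
      ∑ t ∈ comulTypes l, ![1, g k p q, x k p q, g k p q * x k p q] t.1 ⊗ₜ[k]
        ![1, g k p q, x k p q, g k p q * x k p q] t.2 := by
    fin_cases l <;>
      simp [comulTypes, Bialgebra.comul_mul, mul_add, Algebra.TensorProduct.one_def, g_mul_g]
  rw [mono, Bialgebra.comul_mul, hy, hpre, Finset.sum_mul]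
  simp_rw [Finset.mul_sum, mul_smul_comm, Algebra.TensorProduct.tmul_mul_tmul, mono]

lemma pairing_comul_mono (hp : 1 < p) (i j : Fin p × Fin 4) (l : Fin 4) {a : ℕ} (ha : a < p) :
    pairing k p q ((basis k q hp).coord i) ((basis k q hp).coord j)
        (Coalgebra.comul (R := k) (mono k p q l a)) =
      if (i.2, j.2) ∈ comulTypes l ∧ (i.1 + j.1 : ℕ) = a then (a.choose i.1 : k) else 0 := by
  have h (t : Fin 4 × Fin 4) (s : ℕ × ℕ) (hs : s ∈ Finset.HasAntidiagonal.antidiagonal a) :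
      pairing k p q ((basis k q hp).coord i) ((basis k q hp).coord j)
        (a.choose s.1 • (mono k p q t.1 s.1 ⊗ₜ[k] mono k p q t.2 s.2)) =
      if t = (i.2, j.2) then (if s = (i.1.1, j.1.1) then (a.choose i.1 : k) else 0) else 0 := by
    have hs' := Finset.HasAntidiagonal.mem_antidiagonal.1 hs
    rw [map_nsmul, pairing_tmul, basis_coord_mono hp _ _ (by omega),
      basis_coord_mono hp _ _ (by omega)]
    obtain ⟨t1, t2⟩ := t
    obtain ⟨s1, s2⟩ := s
    by_cases h1 : s1 = i.1 <;> by_cases h2 : s2 = j.1 <;> by_cases h3 : t1 = i.2 <;>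
      by_cases h4 : t2 = j.2 <;> simp [h1, h2, h3, h4]
  rw [comul_mono, map_sum]
  simp_rw [map_sum]
  rw [Finset.sum_congr rfl fun t _ => Finset.sum_congr rfl fun s hs => h t s hs]
  by_cases h1 : (i.2, j.2) ∈ comulTypes l <;> by_cases h2 : (i.1 + j.1 : ℕ) = a <;>
    simp [h1, h2, Finset.sum_ite_irrel]

lemma pairing_comul (hp : 1 < p) (i j : Fin p × Fin 4) (z : A k p q) :
    pairing k p q ((basis k q hp).coord i) ((basis k q hp).coord j)
        (Coalgebra.comul (R := k) z) =
      ∑ r : Fin p × Fin 4, (basis k q hp).coord r z *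
        if (i.2, j.2) ∈ comulTypes r.2 ∧ (i.1 + j.1 : ℕ) = r.1 then
          (r.1.1.choose i.1 : k) else 0 := by
  conv_lhs => rw [← sum_coord_mono hp z]
  simp_rw [map_sum, map_smul, pairing_comul_mono hp _ _ _ (Fin.is_lt _), smul_eq_mul]

/-- Coordinates of `Δ(z)` at a pair of monomials of which the second one has no factor `y`. -/
lemma pairing_comul_of_unique (hp : 1 < p) (a c : Fin p) (hc : (c : ℕ) = 0) (i j l : Fin 4)
    (hl : ∀ l', (i, j) ∈ comulTypes l' ↔ l' = l) (z : A k p q) :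
    pairing k p q ((basis k q hp).coord (a, i)) ((basis k q hp).coord (c, j))
      (Coalgebra.comul (R := k) z) = (basis k q hp).coord (a, l) z := by
  rw [pairing_comul, Finset.sum_eq_single (a, l)]
  · simp [hl, hc]
  · rintro ⟨b, l'⟩ _ hne
    rw [if_neg, mul_zero]
    rintro ⟨h1, h2⟩
    rw [hl] at h1
    exact hne (Prod.ext (Fin.ext (by simp_all)) h1)
  · simp

/-- The coordinates of a group-like element at monomials other than `1` and `g` vanish. -/
lemma coord_eq_zero_of_groupLike (hp : 1 < p) {h : A k p q}
    (hh : Coalgebra.comul (R := k) h = h ⊗ₜ h) (i : Fin p × Fin 4)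
    (hi : 2 ≤ i.2 ∨ 0 < (i.1 : ℕ)) : (basis k q hp).coord i h = 0 := by
  obtain ⟨a, l⟩ := i
  induction hn : p - a using Nat.strong_induction_on generalizing a with
  | _ n ih =>
    -- On the diagonal, `h ⊗ h` gives the square of the coordinate. In `Δ(h)` only the monomial of
    -- type `l` and exponent `2a` can contribute, and only if `l < 2`; then `a > 0`, so `2a > a` and
    -- descending induction applies.
    have key := pairing_comul hp (a, l) (a, l) h
    rw [hh, pairing_tmul, Finset.sum_eq_zero, mul_self_eq_zero] at key
    · exact key
    rintro ⟨b, l'⟩ _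
    split_ifs with hb
    · obtain ⟨h1, h2⟩ := hb
      have hl : l' = l ∧ l < 2 := by
        exact (show ∀ l l' : Fin 4, (l, l) ∈ comulTypes l' → l' = l ∧ l < 2 by decide) l l' h1
      obtain ⟨rfl, hl⟩ := hl
      have ha : 0 < (a : ℕ) := by
        rcases hi with hi | hi
        · exact absurd hi (not_le.2 hl)
        · exact hi
      simp only at h2
      rw [ih (p - b) (by omega) b (Or.inr (by simp only; omega)) rfl, zero_mul]
    · rw [mul_zero]

/-- The only group-like elements of `A_(q)` are `1` and `g`. -/
lemma eq_one_or_eq_g_of_groupLike (hp : 1 < p) {h : A k p q}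
    (hh : Coalgebra.comul (R := k) h = h ⊗ₜ h) (hε : Coalgebra.counit (R := k) h = 1) :
    h = 1 ∨ h = g k p q := by
  let o : Fin p := ⟨0, by omega⟩
  set c := (basis k q hp).coord (o, 0) h with hc
  set d := (basis k q hp).coord (o, 1) h with hd
  have hsum : h = c • 1 + d • g k p q := by
    conv_lhs => rw [← sum_coord_mono hp h]
    rw [Fintype.sum_prod_type, Finset.sum_eq_single o]
    · simp only [Fin.sum_univ_four]
      rw [coord_eq_zero_of_groupLike hp hh (o, 2) (Or.inl le_rfl),
        coord_eq_zero_of_groupLike hp hh (o, 3) (Or.inl (show (2 : Fin 4) ≤ 3 by decide))]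
      simp [o, mono_zero_zero, mono_one_zero, hc, hd]
    · intro b _ hb
      refine Finset.sum_eq_zero fun l _ => ?_
      rw [coord_eq_zero_of_groupLike hp hh (b, l) (Or.inr (Nat.pos_of_ne_zero fun h0 =>
        hb (Fin.ext h0))), zero_smul]
    · simp
  -- No coproduct of a monomial contains a term of type `1 ⊗ g`.
  have hcd : c * d = 0 := by
    have key := pairing_comul hp (o, 0) (o, 1) h
    rw [hh, pairing_tmul, Finset.sum_eq_zero] at key
    · exact key
    rintro ⟨b, l⟩ _
    rw [if_neg, mul_zero]
    rintro ⟨h1, -⟩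
    exact (show ∀ l : Fin 4, (0, 1) ∉ comulTypes l by decide) l h1
  have h1 : c + d = 1 := by
    rw [hsum] at hε
    simpa using hε
  rcases mul_eq_zero.1 hcd with h0 | h0
  · right
    rw [hsum, h0, show d = 1 by simpa [h0] using h1]
    simp
  · left
    rw [hsum, h0, show c = 1 by simpa [h0] using h1]
    simp

end coalgebra

/-! ### Skew-primitive elements and isomorphisms -/

section rigidity

variable {k : Type*} [Field k] {p : ℕ} {q : k} [Fact p.Prime] [CharP k p]

/-- A `(1, g)`-primitive element of `A_(q)` that anticommutes with `g` is a multiple of `x`. -/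
lemma eq_smul_x_of_skewPrimitive (hp : 2 < p) {z : A k p q}
    (hz : Coalgebra.comul (R := k) z = z ⊗ₜ 1 + g k p q ⊗ₜ z)
    (hzg : z * g k p q = -(g k p q * z)) : ∃ α : k, z = α • x k p q := by
  have hp1 : 1 < p := by omega
  let o : Fin p := ⟨0, by omega⟩
  have h2k : (2 : k) ≠ 0 := by
    intro h
    have h' : ((2 : ℕ) : k) = 0 := by exact_mod_cast h
    rw [CharP.cast_eq_zero_iff k p] at h'
    exact absurd (Nat.le_of_dvd two_pos h') (by omega)
  have hone (i : Fin p × Fin 4) :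
      (basis k q hp1).coord i 1 = if 0 = (i.1 : ℕ) ∧ 0 = i.2 then 1 else 0 := by
    rw [← mono_zero_zero, basis_coord_mono hp1 _ _ (by omega)]
  have hg (i : Fin p × Fin 4) :
      (basis k q hp1).coord i (g k p q) = if 0 = (i.1 : ℕ) ∧ 1 = i.2 then 1 else 0 := by
    rw [← mono_one_zero, basis_coord_mono hp1 _ _ (by omega)]
  -- Compare coefficients at `g y^a ⊗ x`; `h3` uses `y^a ⊗ g x` in the same way.
  have h2 (a : Fin p) (ha : a ≠ o) : (basis k q hp1).coord (a, 2) z = 0 := by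
    have ha' : (0 : ℕ) ≠ a := fun h => ha (Fin.ext h.symm)
    rw [← pairing_comul_of_unique hp1 a o rfl 1 2 2 (by decide), hz, map_add, pairing_tmul,
      pairing_tmul, hone, hg]
    simp [ha']
  have h3 (a : Fin p) : (basis k q hp1).coord (a, 3) z = 0 := by
    rw [← pairing_comul_of_unique hp1 a o rfl 0 3 3 (by decide), hz, map_add, pairing_tmul,
      pairing_tmul, hone, hg]
    simp
  -- The types `1` and `g` commute with `g`, so anticommutation gives twice the coordinate equal to
  -- zero. This excludes multiples of `1 - g`.
  have h01 (l : Fin 4) (hl : (![1, 1, -1, -1] l : k) = 1) (a : Fin p) :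
      (basis k q hp1).coord (a, l) z = 0 := by
    have h := congrArg ((basis k q hp1).coord (a, ![1, 0, 3, 2] l)) hzg
    rw [map_neg, coord_g_mul, coord_mul_g, hl, one_mul, eq_neg_iff_add_eq_zero, ← two_mul] at h
    exact (mul_eq_zero.1 h).resolve_left h2k
  refine ⟨(basis k q hp1).coord (o, 2) z, ?_⟩
  conv_lhs => rw [← sum_coord_mono hp1 z]
  rw [Finset.sum_eq_single (o, 2)]
  · simp [o, mono_two_zero]
  · rintro ⟨a, l⟩ _ hne
    have : (basis k q hp1).coord (a, l) z = 0 := by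
      fin_cases l
      · exact h01 0 rfl a
      · exact h01 1 rfl a
      · exact h2 a fun h => hne (by rw [h]; rfl)
      · exact h3 a
    rw [this, zero_smul]
  · simp

/-- If `A_(q)` and `A_(q')` are isomorphic then `q` and `q'` agree up to a square in `k^*`
and a `(p-1)`-st root of unity. -/
lemma exists_pow_eq_of_equiv (hp : 2 < p) {q' : k} (f : A k p q ≃ₐc[k] A k p q') :
    ∃ α : k, α ≠ 0 ∧ (α ^ 2 * q') ^ (p - 1) = q ^ (p - 1) := by
  have hp1 : 1 < p := by omega
  have hcomul (z : A k p q) : Coalgebra.comul (R := k) (f z) =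
      TensorProduct.map (f : A k p q →ₗ[k] A k p q') (f : A k p q →ₗ[k] A k p q')
        (Coalgebra.comul (R := k) z) :=
    (CoalgHomClass.map_comp_comul_apply f z).symm
  -- Used with `α = 1` for `g ≠ 1`, and with `α = 0` for `x ≠ 0` and `x² ≠ 0`.
  have hmono (q : k) {l l' : Fin 4} {a a' : ℕ} (ha : a < p) (ha' : a' < p)
      (h : (l, a) ≠ (l', a')) {α : k} (hα : mono k p q l a = α • mono k p q l' a') : False := by
    have := congrArg ((basis k q hp1).coord (⟨a, ha⟩, l)) hα
    rw [map_smul, basis_coord_mono hp1 _ _ ha, basis_coord_mono hp1 _ _ ha'] at this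
    simp only [and_self, if_true, smul_eq_mul] at this
    rw [if_neg fun h' => h (by rw [h'.1, h'.2]), mul_zero] at this
    exact one_ne_zero this
  have hfg : f (g k p q) = g k p q' := by
    refine (eq_one_or_eq_g_of_groupLike hp1 ?_ ?_).resolve_left fun h => ?_
    · rw [hcomul, comul_g]
      rfl
    · rw [CoalgHomClass.counit_comp_apply, counit_g]
    · rw [← map_one f] at h
      have h' := f.injective h
      rw [← mono_one_zero, ← mono_zero_zero, ← one_smul k (mono k p q 0 0)] at h'
      exact hmono q (by omega) (by omega) (by decide) h'
  obtain ⟨α, hα⟩ : ∃ α : k, f (x k p q) = α • x k p q' := by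
    apply eq_smul_x_of_skewPrimitive hp
    · rw [hcomul, comul_x, map_add, TensorProduct.map_tmul, TensorProduct.map_tmul]
      change _ ⊗ₜ f 1 + f _ ⊗ₜ _ = _
      rw [map_one, hfg]
      rfl
    · rw [← hfg, ← map_mul, x_mul_g, map_neg, map_mul]
  have hx0 : x k p q ≠ 0 := fun h => by
    rw [← mono_two_zero, ← zero_smul k (mono k p q 0 0)] at h
    exact hmono q (by omega) (by omega) (by decide) h
  have hα0 : α ≠ 0 := by
    rintro rfl
    rw [zero_smul, ← map_zero f] at hα
    exact hx0 (f.injective hα)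
  refine ⟨α, hα0, ?_⟩
  -- Coefficients of `x²` give `α^{2p} q'^{p-1} = q^{p-1} α²`; then `α²` is cancelled.
  have key := congrArg f (x_pow k p q)
  rw [map_pow, map_smul, map_pow, hα, smul_pow, smul_pow, x_pow, smul_smul, smul_smul] at key
  have hy : (x k p q') ^ 2 = mono k p q' 0 1 := by simp [mono]
  have hy0 : (x k p q') ^ 2 ≠ 0 := fun h => by
    rw [hy, ← zero_smul k (mono k p q' 0 0)] at h
    exact hmono q' (by omega) (by omega) (by decide) h
  have key' := smul_left_injective k hy0 key
  have hpow : α ^ (2 * p) = α ^ 2 * (α ^ 2) ^ (p - 1) := by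
    rw [← pow_succ', pow_mul]
    congr 1
    omega
  rw [hpow, mul_comm (q ^ (p - 1)), mul_assoc] at key'
  rw [mul_pow]
  exact mul_left_cancel₀ (pow_ne_zero 2 hα0) key'

end rigidity

end A

/-! ### Arithmetic of the rational function field and conclusion -/

lemma X_pow_ne {p : ℕ} [Fact p.Prime] (hp : 2 < p) {i j : ℕ+} (hij : i ≠ j) {α : RatFunField p}
    (hα : α ≠ 0) : (α ^ 2 * X p j) ^ (p - 1) ≠ X p i ^ (p - 1) := by
  intro h
  obtain ⟨u, v, hv, rfl⟩ := IsFractionRing.div_surjective (A := MvPolynomial ℕ+ (ZMod p)) α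
  have hv0 : v ≠ 0 := nonZeroDivisors.ne_zero hv
  have hinj : Function.Injective (algebraMap (MvPolynomial ℕ+ (ZMod p)) (RatFunField p)) :=
    IsFractionRing.injective _ _
  have hu0 : u ≠ 0 := by
    rintro rfl
    simp at hα
  have hva : algebraMap _ (RatFunField p) v ≠ 0 := by
    rwa [Ne, map_eq_zero_iff _ hinj]
  have hpoly : (u ^ 2 * MvPolynomial.X j) ^ (p - 1) = (v ^ 2 * MvPolynomial.X i) ^ (p - 1) := by
    apply hinj
    simp only [map_pow, map_mul]
    change _ = (_ * X p i) ^ (p - 1)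
    rw [mul_pow _ (X p i), ← h, ← mul_pow]
    change (_ * X p j) ^ (p - 1) = _
    field_simp
  have hX : Prime (MvPolynomial.X i : MvPolynomial ℕ+ (ZMod p)) := MvPolynomial.X_prime
  -- Orders at `X_i`: `(p-1) · 2 ord(u)` on the left, `(p-1)(2 ord(v) + 1)` on the right. Cancelling
  -- `p - 1` equates an even and an odd number.
  have hm := congrArg (emultiplicity (MvPolynomial.X i)) hpoly
  have hXj : emultiplicity (MvPolynomial.X i : MvPolynomial ℕ+ (ZMod p)) (MvPolynomial.X j) = 0 :=
    emultiplicity_eq_zero.2 fun h => hij (MvPolynomial.X_dvd_X.1 h)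
  have hXi : emultiplicity (MvPolynomial.X i : MvPolynomial ℕ+ (ZMod p)) (MvPolynomial.X i) = 1 := by
    simpa using emultiplicity_pow_self_of_prime hX 1
  rw [emultiplicity_pow hX, emultiplicity_pow hX, emultiplicity_mul hX, emultiplicity_mul hX,
    emultiplicity_pow hX, emultiplicity_pow hX, hXj, hXi,
    (FiniteMultiplicity.of_prime_left hX hu0).emultiplicity_eq_multiplicity,
    (FiniteMultiplicity.of_prime_left hX hv0).emultiplicity_eq_multiplicity] at hm
  norm_cast at hm
  have := Nat.eq_of_mul_eq_mul_left (by omega) hm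
  omega

lemma isEmpty_equiv {p : ℕ} [Fact p.Prime] (hp : 2 < p) {i j : ℕ+} (hij : i ≠ j) :
    IsEmpty (A (RatFunField p) p (X p i) ≃ₐc[RatFunField p] A (RatFunField p) p (X p j)) :=
  ⟨fun f => by
    obtain ⟨α, hα, h⟩ := A.exists_pow_eq_of_equiv hp f
    exact X_pow_ne hp hij hα h⟩

lemma hopfIsoClasses_infinite :
    (hopfIsoClasses (RatFunField 3) 12).Infinite := by
  refine Set.infinite_of_injective_forall_mem
    (f := fun i : ℕ+ => Quotient.mk (CategoryTheory.isIsomorphicSetoid _)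
      (HopfAlgCat.of (RatFunField 3) (A (RatFunField 3) 3 (X 3 i)))) ?_ ?_
  · intro i j h
    by_contra hij
    obtain ⟨e⟩ := Quotient.exact h
    exact (isEmpty_equiv (by norm_num) hij).false e.toHopfAlgEquiv
  · intro i
    exact ⟨_, A.finrank_eq (by norm_num), rfl⟩

end SweedlerCrossed

end

theorem mainTheorem8 :
    (∀ (p : ℕ) [Fact p.Prime], 3 ≤ p →
      (∀ i : ℕ+, Module.finrank (SweedlerCrossed.RatFunField p)
        (SweedlerCrossed.A (SweedlerCrossed.RatFunField p) p (SweedlerCrossed.X p i)) = 4 * p) ∧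
      (∀ i j : ℕ+, i ≠ j →
        IsEmpty
          (SweedlerCrossed.A (SweedlerCrossed.RatFunField p) p (SweedlerCrossed.X p i)
            ≃ₐc[SweedlerCrossed.RatFunField p]
          SweedlerCrossed.A (SweedlerCrossed.RatFunField p) p (SweedlerCrossed.X p j)))) ∧
    (CharP (SweedlerCrossed.RatFunField 3) 3 ∧
      (SweedlerCrossed.hopfIsoClasses (SweedlerCrossed.RatFunField 3) 12).Infinite) := by
  refine ⟨fun p _ hp => ⟨fun i => SweedlerCrossed.A.finrank_eq (by omega),
    fun i j hij => SweedlerCrossed.isEmpty_equiv hp hij⟩, inferInstance,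
    SweedlerCrossed.hopfIsoClasses_infinite⟩
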